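/- Consider a two-layer caching network: a server holds $N$ files of $F$ bits and is connected by a shared link to $K_1\ge 2$ helpers; helper $i$ is connected by a shared link to $K_2\ge 2$ users $(i,1),\dots,(i,K_2)$. Each helper can store $M_1F$ bits and each user $M_2F$ bits, $0\le M_1,M_2\le N$. User $(i,j)$ requests file $d_{i,j}$, where the requests are arbitrary but fixed. For a message of $b$ bits, $b/F$ is called its rate. Placement: independently over nodes and files, every helper stores a uniformly random set of $\lfloor M_1F/N\rfloor$ bits, and every user a uniformly random set of $\lfloor M_2F/N\rfloor$ bits, of each file. The placement pattern (which positions are stored where) and the requests are known to all nodes. For $T\subseteq\{1,\dots,K_1\}$ let $V_{d_{i,j},T}$ be the string of bits of file $d_{i,j}$ stored by exactly the helpers in $T$ among all helpers, and let $V^{\bar U}_{d_{i,j},T}$ be its substring of bits not stored by user $(i,j)$. For $T\subseteq\{1,\dots,K_2\}$ let $V^{(i)}_{d_{i,j},T}$ be the string of bits of file $d_{i,j}$ stored by exactly the users $(i,j')$, $j'\in T$, among the users of helper $i$. Below $\oplus$ is bitwise XOR after zero-padding to the longest string. Delivery of the S&C scheme: the server sends $\bigoplus_{i\in S}V^{\bar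 U}_{d_{i,j},S\setminus\{i\}}$ for all nonempty $S\subseteq\{1,\dots,K_1\}$ and all $j\in\{1,\dots,K_2\}$; helper $i$ sends $\bigoplus_{j\in S}V^{(i)}_{d_{i,j},S\setminus\{j\}}$ for all nonempty $S\subseteq\{1,\dots,K_2\}$. Scheme A uses the same placement and the same helper messages, but the server sends $\bigoplus_{i\in S}V_{d_{i,j},S\setminus\{i\}}$. Then the stored bits fit in the memories and, for every $F$, every placement pattern and in both schemes, each helper can compute its message from its stored bits and the server message (in scheme A it can even recover all files requested by its users), and each user recovers its requested file from its stored bits and its helper's message. Moreover, as $F\to\infty$: (a) if $M_1>0$, the rate of the server message in the S&C scheme converges in probability to $$R_1^{S\&C}=K_2\Bigl(1-\frac{M_1}{N}\Bigr)\Bigl(1-\frac{M_2}{N}\Bigr)\frac{N}{M_1}\Bigl(1-\Bigl(1-\frac{M_1}{N}\Bigr)^{K_1}\Bigr),$$ and in scheme A to $R_1^{A}=K_2\bigl(1-\frac{M_1}{N}\bigr)\frac{N}{M_1}\bigl(1-(1-\frac{M_1}{N})^{K_1}\bigr)$; (b) if $M_2>0$, in both schemes the rate of each helper's message, and the maximum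 of these rates over the helpers, converge in probability to $$R_2^{S\&C}=R_2^{A}=\Bigl(1-\frac{M_2}{N}\Bigr)\frac{N}{M_2}\Bigl(1-\Bigl(1-\frac{M_2}{N}\Bigr)^{K_2}\Bigr).$$ For $M_1>0$ we have $R_1^{S\&C}=\bigl(1-\frac{M_2}{N}\bigr)R_1^{A}$, so $R_1^{S\&C}<R_1^{A}$ if moreover $M_1<N$ and $M_2>0$, while the helper rates of the two schemes agree. -/

import Mathlib

open Filter Topology
open scoped ENNReal

namespace TwoLayerCaching

/-! ### One layer of decentralized coded multicasting

`K` nodes have cached parts of `N` files of `F` bits; `C k n` is the set of positions of file `n`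
that node `k` has cached. Node `k` asks for the bits of file `dem k` at the positions in
`wanted k` that it has not cached. -/

section Layer

variable {K N F : ℕ}

/-- The positions of file `n` cached at exactly the nodes in `T` and at no other node. -/
def subfile (C : Fin K → Fin N → Finset (Fin F)) (n : Fin N) (T : Finset (Fin K)) :
    Finset (Fin F) :=
  Finset.univ.filter fun b => ∀ k, b ∈ C k n ↔ k ∈ T

/-- The contribution of node `k ∈ S` to the coded block of `S`: the wanted positions of its
requested file that are cached exactly at the nodes in `S` other than `k`. -/
def piece (C : Fin K → Fin N → Finset (Fin F)) (dem : Fin K → Fin N)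
    (wanted : Fin K → Finset (Fin F)) (S : Finset (Fin K)) (k : Fin K) : Finset (Fin F) :=
  subfile C (dem k) (S.erase k) ∩ wanted k

/-- Number of bits of the coded block of `S`: shorter pieces are zero-padded to the longest. -/
def blockLength (C : Fin K → Fin N → Finset (Fin F)) (dem : Fin K → Fin N)
    (wanted : Fin K → Finset (Fin F)) (S : Finset (Fin K)) : ℕ :=
  S.sup fun k => (piece C dem wanted S k).card

/-- The bit positions of the whole coded message: one block for each nonempty set of nodes. -/
abbrev CodeIndex (C : Fin K → Fin N → Finset (Fin F)) (dem : Fin K → Fin N)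
    (wanted : Fin K → Finset (Fin F)) : Type :=
  Σ S : {S : Finset (Fin K) // S.Nonempty}, Fin (blockLength C dem wanted S.1)

/-- The bits of `f` at the positions in `A`, in increasing order, followed by zeros. -/
def padded (f : Fin F → ZMod 2) (A : Finset (Fin F)) (t : ℕ) : ZMod 2 :=
  if h : t < A.card then f (A.orderEmbOfFin rfl ⟨t, h⟩) else 0

/-- The coded message: the block of `S` is the XOR over `k ∈ S` of the zero-padded pieces. -/
def codedMessage (C : Fin K → Fin N → Finset (Fin F)) (dem : Fin K → Fin N)
    (wanted : Fin K → Finset (Fin F)) (W : Fin N → Fin F → ZMod 2) :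
    CodeIndex C dem wanted → ZMod 2 :=
  fun x => ∑ k ∈ x.1.1, padded (W (dem k)) (piece C dem wanted x.1.1 k) x.2

end Layer

/-! ### Random placement -/

/-- A choice of `m` of the `F` bits of a file. -/
abbrev BitChoice (F m : ℕ) : Type := {A : Finset (Fin F) // A.card = m}

/-- A joint outcome of the placement: each of the `K1` helpers chooses `m1` bits of each of the `N`
files, each of the `K1 * K2` users chooses `m2` bits of each file. -/
abbrev Placement (K1 K2 N F m1 m2 : ℕ) : Type :=
  (Fin K1 → Fin N → BitChoice F m1) × (Fin K1 → Fin K2 → Fin N → BitChoice F m2)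

/-- Number of bits of each file that a node with normalized memory `M` selects. -/
noncomputable def bitsPerFile (M : ℝ) (N F : ℕ) : ℕ := ⌊M * F / N⌋₊

/-- Probability under the uniform law on a finite type. For a product type, such as `Placement`,
this is the law of independent uniformly distributed coordinates. -/
noncomputable def unifProb {Ω : Type} (E : Set Ω) : ℝ≥0∞ :=
  letI : MeasurableSpace Ω := ⊤
  ProbabilityTheory.uniformOn (Set.univ : Set Ω) E

/-- `X F → c` in probability as `F → ∞`, with `X F` defined on `Ω F` under its uniform law. -/
def ConvergesInProbability {Ω : ℕ → Type} (X : ∀ F, Ω F → ℝ) (c : ℝ) : Prop :=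
  ∀ ε : ℝ, 0 < ε → Tendsto (fun F => unifProb {ω : Ω F | |X F ω - c| < ε}) atTop (𝓝 1)

/-! ### The two-layer network -/

section Network

variable {K1 K2 N F m1 m2 : ℕ}

/-- Positions cached by the helpers. -/
def helperSets (ω : Placement K1 K2 N F m1 m2) : Fin K1 → Fin N → Finset (Fin F) :=
  fun i n => (ω.1 i n).1

/-- Positions cached by the users attached to helper `i`. -/
def userSets (ω : Placement K1 K2 N F m1 m2) (i : Fin K1) : Fin K2 → Fin N → Finset (Fin F) :=
  fun j n => (ω.2 i j n).1

/-- The possible contents of a cache that stores the positions in `A n` of every file `n`. -/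
abbrev CacheContent (A : Fin N → Finset (Fin F)) : Type := (Σ n : Fin N, {b // b ∈ A n}) → ZMod 2

/-- The content of such a cache when the files are `W`. -/
def cacheContent (A : Fin N → Finset (Fin F)) (W : Fin N → Fin F → ZMod 2) : CacheContent A :=
  fun x => W x.1 x.2.1

/-- Bit positions of the server message: for each `j`, one coded layer addressed to the helpers,
in which helper `i` asks for the file `d i j` on behalf of its `j`-th user. -/
abbrev ServerIndex (ω : Placement K1 K2 N F m1 m2) (d : Fin K1 → Fin K2 → Fin N)
    (wanted : Fin K1 → Fin K2 → Finset (Fin F)) : Type :=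
  Σ j : Fin K2, CodeIndex (helperSets ω) (fun i => d i j) (fun i => wanted i j)

/-- The message of the server. -/
def serverMessage (ω : Placement K1 K2 N F m1 m2) (d : Fin K1 → Fin K2 → Fin N)
    (wanted : Fin K1 → Fin K2 → Finset (Fin F)) (W : Fin N → Fin F → ZMod 2) :
    ServerIndex ω d wanted → ZMod 2 :=
  fun x => codedMessage (helperSets ω) (fun i => d i x.1) (fun i => wanted i x.1) W x.2

/-- Scheme S&C: bits of `d i j` that user `(i, j)` has cached are not delivered to helper `i`. -/
def wantedSC (ω : Placement K1 K2 N F m1 m2) (d : Fin K1 → Fin K2 → Fin N) :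
    Fin K1 → Fin K2 → Finset (Fin F) :=
  fun i j => (userSets ω i j (d i j))ᶜ

/-- Scheme A: helpers are delivered the requested files whatever the users have cached. -/
def wantedA (K1 K2 F : ℕ) : Fin K1 → Fin K2 → Finset (Fin F) := fun _ _ => Finset.univ

/-- Bit positions of the message of helper `i`: one coded layer addressed to its users. -/
abbrev HelperIndex (ω : Placement K1 K2 N F m1 m2) (d : Fin K1 → Fin K2 → Fin N) (i : Fin K1) :
    Type :=
  CodeIndex (userSets ω i) (d i) (fun _ => Finset.univ)

/-- The message of helper `i` (the same in schemes S&C and A). -/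
def helperMessage (ω : Placement K1 K2 N F m1 m2) (d : Fin K1 → Fin K2 → Fin N) (i : Fin K1)
    (W : Fin N → Fin F → ZMod 2) : HelperIndex ω d i → ZMod 2 :=
  codedMessage (userSets ω i) (d i) (fun _ => Finset.univ) W

/-- Number of bits sent by the server, normalized by the file size. -/
noncomputable def serverRate (ω : Placement K1 K2 N F m1 m2) (d : Fin K1 → Fin K2 → Fin N)
    (wanted : Fin K1 → Fin K2 → Finset (Fin F)) : ℝ :=
  (Fintype.card (ServerIndex ω d wanted) : ℝ) / F

/-- Number of bits sent by helper `i`, normalized by the file size. -/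
noncomputable def helperRate (ω : Placement K1 K2 N F m1 m2) (d : Fin K1 → Fin K2 → Fin N)
    (i : Fin K1) : ℝ :=
  (Fintype.card (HelperIndex ω d i) : ℝ) / F

/-- The largest number of bits sent by a helper, normalized by the file size. -/
noncomputable def maxHelperRate (ω : Placement K1 K2 N F m1 m2) (d : Fin K1 → Fin K2 → Fin N) : ℝ :=
  ((Finset.univ.sup fun i => Fintype.card (HelperIndex ω d i) : ℕ) : ℝ) / F

/-- Each helper can form its message from its own cache and the server message. -/
def HelpersCanSend (ω : Placement K1 K2 N F m1 m2) (d : Fin K1 → Fin K2 → Fin N)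
    (wanted : Fin K1 → Fin K2 → Finset (Fin F)) : Prop :=
  ∀ i, ∃ φ : CacheContent (helperSets ω i) → (ServerIndex ω d wanted → ZMod 2) →
      (HelperIndex ω d i → ZMod 2),
    ∀ W, φ (cacheContent (helperSets ω i) W) (serverMessage ω d wanted W) = helperMessage ω d i W

/-- Each helper can resolve all files requested by its users from its own cache and the server
message. -/
def HelpersResolve (ω : Placement K1 K2 N F m1 m2) (d : Fin K1 → Fin K2 → Fin N)
    (wanted : Fin K1 → Fin K2 → Finset (Fin F)) : Prop :=
  ∀ i j, ∃ φ : CacheContent (helperSets ω i) → (ServerIndex ω d wanted → ZMod 2) →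
      (Fin F → ZMod 2),
    ∀ W, φ (cacheContent (helperSets ω i) W) (serverMessage ω d wanted W) = W (d i j)

/-- Each user can recover its file from its own cache and the message of its helper. -/
def UsersRecover (ω : Placement K1 K2 N F m1 m2) (d : Fin K1 → Fin K2 → Fin N) : Prop :=
  ∀ i j, ∃ ψ : CacheContent (userSets ω i j) → (HelperIndex ω d i → ZMod 2) → (Fin F → ZMod 2),
    ∀ W, ψ (cacheContent (userSets ω i j) W) (helperMessage ω d i W) = W (d i j)

end Network

/-! ### The closed forms -/

/-- Server rate of scheme S&C. -/
noncomputable def R1SC (K1 K2 N : ℕ) (M1 M2 : ℝ) : ℝ :=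
  K2 * (1 - M1 / N) * (1 - M2 / N) * (N / M1) * (1 - (1 - M1 / N) ^ K1)

/-- Helper rate of scheme S&C. -/
noncomputable def R2SC (K2 N : ℕ) (M2 : ℝ) : ℝ :=
  (1 - M2 / N) * (N / M2) * (1 - (1 - M2 / N) ^ K2)

/-- Server rate of scheme A. -/
noncomputable def R1A (K1 K2 N : ℕ) (M1 : ℝ) : ℝ :=
  K2 * (1 - M1 / N) * (N / M1) * (1 - (1 - M1 / N) ^ K1)

/-- Helper rate of scheme A. -/
noncomputable def R2A (K2 N : ℕ) (M2 : ℝ) : ℝ :=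
  (1 - M2 / N) * (N / M2) * (1 - (1 - M2 / N) ^ K2)

end TwoLayerCaching

open TwoLayerCaching

/-!
Delivery. In a coded layer, a wanted bit that node `k` lacks is cached exactly at some set `T` of
nodes with `k ∉ T`. In the block of `insert k T` all other pieces are cached at `k`, which can
therefore cancel them (`codedMessage_resolves`). The message of a helper only involves bits that the
requesting user lacks, so the bits delivered in scheme S&C suffice to form it. Decoders are obtained
from the fact that cache and message determine the target (`exists_decoder`).

Rates. The normalized length of a coded message is a finite sum of maxima of relative sizes
`|piece| / F`, so it is enough that each of these converges in `L¹`
(`ConvergesInMean.sum`, `ConvergesInMean.sup`); Markov's inequality then gives convergence in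
probability. A piece is an intersection of independent random sets, each of them a uniformly chosen
set of given size or the complement of one. Such a set contains every point with a common
probability `α` and every pair of distinct points with a common probability `β`
(`PairUniform`), and when `α → c` and `β → c ^ 2` the second moment of `|A| / F - c` tends to zero
(`HasDensity.convergesInMean`). This property is stable under complements and independent
intersections, and it holds for the uniform choice by symmetry (`pairUniform_bitChoice`). Hence a
subfile cached exactly at `T` has density `p ^ |T| * (1 - p) ^ (K - |T|)`, and the binomial theorem
sums the block lengths to the closed form (`convergesInMean_card_codeIndex`).
-/

open scoped BigOperators

namespace TwoLayerCaching

/-! ### Decoding -/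

section Decoding

variable {K N F : ℕ}

/-- A target can be computed from two observations as soon as the observations determine it. -/
lemma exists_decoder {α β γ ι : Type*} [Nonempty γ] (f : ι → α) (g : ι → β) (t : ι → γ)
    (h : ∀ w w', f w = f w' → g w = g w' → t w = t w') :
    ∃ φ : α → β → γ, ∀ w, φ (f w) (g w) = t w := by
  have hfac : t.FactorsThrough fun w => (f w, g w) := fun w w' hw =>
    h w w' (congrArg Prod.fst hw) (congrArg Prod.snd hw)
  obtain ⟨e, he⟩ := (Function.factorsThrough_iff t).1 hfac
  exact ⟨fun a b => e (a, b), fun w => (congrFun he w).symm⟩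

lemma padded_congr {f g : Fin F → ZMod 2} {A : Finset (Fin F)} (h : ∀ b ∈ A, f b = g b) (t : ℕ) :
    padded f A t = padded g A t := by
  unfold padded
  split_ifs
  · exact h _ (A.orderEmbOfFin_mem rfl _)
  · rfl

lemma exists_padded_eq {A : Finset (Fin F)} {b : Fin F} (hb : b ∈ A) :
    ∃ t < A.card, ∀ f : Fin F → ZMod 2, padded f A t = f b := by
  have hr : b ∈ Set.range (A.orderEmbOfFin rfl) := by simpa using hb
  obtain ⟨t, rfl⟩ := hr
  exact ⟨t, t.2, fun f => by simp [padded]⟩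

lemma mem_subfile {C : Fin K → Fin N → Finset (Fin F)} {n : Fin N} {T : Finset (Fin K)}
    {b : Fin F} : b ∈ subfile C n T ↔ ∀ k, b ∈ C k n ↔ k ∈ T := by
  simp [subfile]

/-- Every node of a layer can resolve its wanted bits. A wanted bit `b` that node `k` lacks is
cached exactly at some set `T` of nodes not containing `k`; in the block of `insert k T` every
other piece is cached at `k`, so that it can be cancelled. -/
lemma codedMessage_resolves {C : Fin K → Fin N → Finset (Fin F)} {dem : Fin K → Fin N}
    {wanted : Fin K → Finset (Fin F)} {W W' : Fin N → Fin F → ZMod 2} {k : Fin K}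
    (hcache : ∀ n, ∀ b ∈ C k n, W n b = W' n b)
    (hmsg : codedMessage C dem wanted W = codedMessage C dem wanted W')
    {b : Fin F} (hb : b ∈ wanted k) : W (dem k) b = W' (dem k) b := by
  by_cases hbk : b ∈ C k (dem k)
  · exact hcache _ _ hbk
  set T : Finset (Fin K) := Finset.univ.filter fun k' => b ∈ C k' (dem k) with hT
  have hkT : k ∉ T := by simpa [hT] using hbk
  set S := insert k T with hS
  have hkS : k ∈ S := Finset.mem_insert_self _ _
  have hbp : b ∈ piece C dem wanted S k := by
    refine Finset.mem_inter.2 ⟨?_, hb⟩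
    rw [hS, Finset.erase_insert hkT, mem_subfile]
    simp [hT]
  obtain ⟨t, ht, hpad⟩ := exists_padded_eq hbp
  have htS : t < blockLength C dem wanted S :=
    ht.trans_le (Finset.le_sup (f := fun k => (piece C dem wanted S k).card) hkS)
  have hblock := congrFun hmsg ⟨⟨S, ⟨k, hkS⟩⟩, ⟨t, htS⟩⟩
  simp only [codedMessage] at hblock
  rw [← Finset.add_sum_erase _ _ hkS, ← Finset.add_sum_erase _ _ hkS, hpad, hpad] at hblock
  have hrest : ∑ k' ∈ S.erase k, padded (W (dem k')) (piece C dem wanted S k') t =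
      ∑ k' ∈ S.erase k, padded (W' (dem k')) (piece C dem wanted S k') t := by
    refine Finset.sum_congr rfl fun k' hk' => padded_congr (fun c hc => hcache _ _ ?_) _
    have hc' := mem_subfile.1 (Finset.mem_inter.1 hc).1 k
    exact hc'.2 (Finset.mem_erase.2 ⟨(Finset.ne_of_mem_erase hk').symm, hkS⟩)
  rw [hrest] at hblock
  exact add_right_cancel hblock

lemma eq_of_cacheContent_eq {A : Fin N → Finset (Fin F)} {W W' : Fin N → Fin F → ZMod 2}
    (h : cacheContent A W = cacheContent A W') (n : Fin N) (b : Fin F) (hb : b ∈ A n) :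
    W n b = W' n b :=
  congrFun h ⟨n, b, hb⟩

variable {K1 K2 m1 m2 : ℕ} (ω : Placement K1 K2 N F m1 m2) (d : Fin K1 → Fin K2 → Fin N)

lemma eq_of_serverMessage_eq {wanted : Fin K1 → Fin K2 → Finset (Fin F)}
    {W W' : Fin N → Fin F → ZMod 2} {i : Fin K1}
    (hcache : cacheContent (helperSets ω i) W = cacheContent (helperSets ω i) W')
    (hmsg : serverMessage ω d wanted W = serverMessage ω d wanted W') (j : Fin K2) {b : Fin F}
    (hb : b ∈ wanted i j) : W (d i j) b = W' (d i j) b :=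
  codedMessage_resolves (C := helperSets ω) (dem := fun i => d i j)
    (wanted := fun i => wanted i j) (eq_of_cacheContent_eq hcache)
    (funext fun x => congrFun hmsg ⟨j, x⟩) hb

/-- The message of helper `i` only involves, of each requested file, bits that the requesting user
lacks. Hence helper `i` need not be delivered the others. -/
lemma helpersCanSend_of_compl_subset {wanted : Fin K1 → Fin K2 → Finset (Fin F)}
    (hw : ∀ i j, (userSets ω i j (d i j))ᶜ ⊆ wanted i j) : HelpersCanSend ω d wanted := by
  intro i
  refine exists_decoder _ _ _ fun W W' hcache hmsg => funext fun x => ?_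
  refine Finset.sum_congr rfl fun j _ => padded_congr (fun b hb => ?_) _
  refine eq_of_serverMessage_eq ω d hcache hmsg j (hw i j ?_)
  have hb' := mem_subfile.1 (Finset.mem_inter.1 hb).1 j
  simpa using hb'

lemma helpersResolve_wantedA : HelpersResolve ω d (wantedA K1 K2 F) := fun i j =>
  exists_decoder _ _ (fun W : Fin N → Fin F → ZMod 2 => W (d i j)) fun _ _ hcache hmsg =>
    funext fun b => eq_of_serverMessage_eq ω d hcache hmsg j (Finset.mem_univ b)

lemma usersRecover : UsersRecover ω d := fun i j =>
  exists_decoder _ _ (fun W : Fin N → Fin F → ZMod 2 => W (d i j)) fun _ _ hcache hmsg =>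
    funext fun b => codedMessage_resolves (eq_of_cacheContent_eq hcache) hmsg (Finset.mem_univ b)

end Decoding

/-! ### Expectations over finite product spaces -/

section Expectation

/-- The map `π` pushes the uniform law on `Ω'` forward to the uniform law on `Ω`. -/
def UniformPreserving {Ω' Ω : Type} [Fintype Ω'] [Fintype Ω] (π : Ω' → Ω) : Prop :=
  ∀ f : Ω → ℝ, 𝔼 ω, f (π ω) = 𝔼 y, f y

lemma expect_prod_mul {Ω₁ Ω₂ : Type} [Fintype Ω₁] [Fintype Ω₂] (f : Ω₁ → ℝ) (g : Ω₂ → ℝ) :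
    𝔼 ω : Ω₁ × Ω₂, f ω.1 * g ω.2 = (𝔼 x, f x) * 𝔼 y, g y := by
  rw [Fintype.expect_mul_expect, ← Finset.univ_product_univ, Finset.expect_product]

lemma expect_pi_prod {ι Y : Type} [Fintype ι] [DecidableEq ι] [Fintype Y] (f : ι → Y → ℝ) :
    𝔼 ω : ι → Y, ∏ k, f k (ω k) = ∏ k, 𝔼 y, f k y := by
  simp only [Fintype.expect_eq_sum_div_card, Finset.prod_div_distrib, Finset.prod_univ_sum,
    Fintype.piFinset_univ, Finset.prod_const, Finset.card_univ, Fintype.card_fun, Nat.cast_pow]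

lemma UniformPreserving.fst {Ω₁ Ω₂ : Type} [Fintype Ω₁] [Fintype Ω₂] [Nonempty Ω₂] :
    UniformPreserving (Prod.fst : Ω₁ × Ω₂ → Ω₁) := fun f => by
  simpa using expect_prod_mul f (fun _ : Ω₂ => (1 : ℝ))

lemma UniformPreserving.snd {Ω₁ Ω₂ : Type} [Fintype Ω₁] [Fintype Ω₂] [Nonempty Ω₁] :
    UniformPreserving (Prod.snd : Ω₁ × Ω₂ → Ω₂) := fun f => by
  simpa using expect_prod_mul (fun _ : Ω₁ => (1 : ℝ)) f

lemma UniformPreserving.eval {ι Y : Type} [Fintype ι] [DecidableEq ι] [Fintype Y] [Nonempty Y]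
    (i : ι) : UniformPreserving (fun ω : ι → Y => ω i) := fun f => by
  have h := expect_pi_prod (fun (k : ι) (y : Y) => if k = i then f y else 1)
  have h1 (k : ι) : (𝔼 y : Y, if k = i then f y else 1) = if k = i then 𝔼 y, f y else 1 := by
    split_ifs <;> simp
  simpa [h1, Finset.prod_ite_eq'] using h

lemma UniformPreserving.comp {Ω₁ Ω₂ Ω₃ : Type} [Fintype Ω₁] [Fintype Ω₂] [Fintype Ω₃]
    {π : Ω₁ → Ω₂} {ρ : Ω₂ → Ω₃} (hρ : UniformPreserving ρ) (hπ : UniformPreserving π) :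
    UniformPreserving fun ω => ρ (π ω) := fun f =>
  (hπ fun y => f (ρ y)).trans (hρ f)

end Expectation

/-! ### Random sets with uniform pair correlations -/

section PairUniform

variable {Ω Ω' : Type} [Fintype Ω] [Fintype Ω'] {F : ℕ}

/-- A random subset of `Fin F`, defined on `Ω` with its uniform law, that contains every point with
probability `α` and every pair of distinct points with probability `β`. -/
structure PairUniform (A : Ω → Finset (Fin F)) (α β : ℝ) : Prop where
  point : ∀ b, (𝔼 ω, if b ∈ A ω then (1 : ℝ) else 0) = α
  pair : ∀ b b', b ≠ b' →
    (𝔼 ω, (if b ∈ A ω then (1 : ℝ) else 0) * if b' ∈ A ω then 1 else 0) = β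

lemma cast_card_eq_sum (A : Finset (Fin F)) :
    (A.card : ℝ) = ∑ b, if b ∈ A then (1 : ℝ) else 0 := by
  simp

namespace PairUniform

lemma expect_card {A : Ω → Finset (Fin F)} {α β : ℝ} (h : PairUniform A α β) :
    𝔼 ω, ((A ω).card : ℝ) = F * α := by
  simp only [cast_card_eq_sum]
  rw [Finset.expect_sum_comm]
  simp [h.point]

lemma expect_card_sq {A : Ω → Finset (Fin F)} {α β : ℝ} (h : PairUniform A α β) :
    𝔼 ω, ((A ω).card : ℝ) ^ 2 = F * (α + (F - 1) * β) := by
  simp only [cast_card_eq_sum, sq, Finset.sum_mul_sum]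
  rw [Finset.expect_sum_comm]
  have hrow (b : Fin F) : (𝔼 ω, ∑ b', (if b ∈ A ω then (1 : ℝ) else 0) *
      if b' ∈ A ω then 1 else 0) = α + (F - 1) * β := by
    rw [Finset.expect_sum_comm, ← Finset.add_sum_erase _ _ (Finset.mem_univ b)]
    congr 1
    · rw [← h.point b]
      exact Finset.expect_congr rfl fun ω _ => by split_ifs <;> simp
    · rw [Finset.sum_congr rfl fun b' hb' => h.pair b b' (Finset.ne_of_mem_erase hb').symm]
      have hF : 1 ≤ F := b.pos
      simp [Nat.cast_sub hF]
  rw [Finset.sum_congr rfl fun b _ => hrow b, Finset.sum_const, Finset.card_univ, Fintype.card_fin,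
    nsmul_eq_mul]

lemma expect_sq_sub [Nonempty Ω] {A : Ω → Finset (Fin F)} {α β : ℝ} (h : PairUniform A α β)
    (hF : F ≠ 0) (c : ℝ) :
    𝔼 ω, (((A ω).card : ℝ) / F - c) ^ 2
      = α * (1 / F) + (1 - 1 / F) * β - 2 * c * α + c ^ 2 := by
  have hF' : (F : ℝ) ≠ 0 := Nat.cast_ne_zero.2 hF
  have hexp (ω : Ω) : (((A ω).card : ℝ) / F - c) ^ 2 =
      ((A ω).card : ℝ) ^ 2 * (1 / (F : ℝ) ^ 2) - ((A ω).card : ℝ) * (2 * c / F) + c ^ 2 := by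
    field_simp
    ring
  simp only [hexp, Finset.expect_add_distrib, Finset.expect_sub_distrib, ← Finset.expect_mul,
    h.expect_card, h.expect_card_sq, Fintype.expect_const]
  field_simp

lemma comp {A : Ω → Finset (Fin F)} {α β : ℝ} (h : PairUniform A α β) {π : Ω' → Ω}
    (hπ : UniformPreserving π) : PairUniform (fun ω => A (π ω)) α β where
  point b := (hπ fun ω => if b ∈ A ω then (1 : ℝ) else 0).trans (h.point b)
  pair b b' hb := (hπ fun ω => (if b ∈ A ω then (1 : ℝ) else 0) *
    if b' ∈ A ω then 1 else 0).trans (h.pair b b' hb)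

lemma compl [Nonempty Ω] {A : Ω → Finset (Fin F)} {α β : ℝ} (h : PairUniform A α β) :
    PairUniform (fun ω => (A ω)ᶜ) (1 - α) (1 - 2 * α + β) where
  point b := by
    have hexp (ω : Ω) : (if b ∈ (A ω)ᶜ then (1 : ℝ) else 0) = 1 - if b ∈ A ω then 1 else 0 := by
      by_cases hb : b ∈ A ω <;> simp [hb]
    simp only [hexp, Finset.expect_sub_distrib, h.point, Fintype.expect_const]
  pair b b' hb := by
    have hexp (ω : Ω) : ((if b ∈ (A ω)ᶜ then (1 : ℝ) else 0) * if b' ∈ (A ω)ᶜ then 1 else 0) =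
        1 - (if b ∈ A ω then 1 else 0) - (if b' ∈ A ω then 1 else 0)
          + (if b ∈ A ω then 1 else 0) * if b' ∈ A ω then 1 else 0 := by
      by_cases hb : b ∈ A ω <;> by_cases hb' : b' ∈ A ω <;> simp [hb, hb']
    simp only [hexp, Finset.expect_add_distrib, Finset.expect_sub_distrib, h.point, h.pair b b' hb,
      Fintype.expect_const]
    ring

lemma inter {A : Ω → Finset (Fin F)} {B : Ω' → Finset (Fin F)} {α β α' β' : ℝ}
    (hA : PairUniform A α β) (hB : PairUniform B α' β') :
    PairUniform (fun ω : Ω × Ω' => A ω.1 ∩ B ω.2) (α * α') (β * β') where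
  point b := by
    rw [← hA.point b, ← hB.point b, ← expect_prod_mul]
    exact Finset.expect_congr rfl fun ω _ => by
      by_cases h : b ∈ A ω.1 <;> by_cases h' : b ∈ B ω.2 <;> simp [h, h']
  pair b b' hb := by
    rw [← hA.pair b b' hb, ← hB.pair b b' hb, ← expect_prod_mul]
    simp only [Finset.mem_inter, ite_and]
    exact Finset.expect_congr rfl fun ω _ => by split_ifs <;> simp

lemma iInter {ι : Type} [Fintype ι] [DecidableEq ι] {A : ι → Ω → Finset (Fin F)} {α β : ι → ℝ}
    (h : ∀ k, PairUniform (A k) (α k) (β k)) :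
    PairUniform (fun ω : ι → Ω => Finset.univ.filter fun b => ∀ k, b ∈ A k (ω k))
      (∏ k, α k) (∏ k, β k) where
  point b := by
    simp only [← (h _).point b, ← expect_pi_prod, Finset.prod_boole]
    simp
  pair b b' hb := by
    simp only [← (h _).pair b b' hb, ← expect_pi_prod, Finset.prod_mul_distrib, Finset.prod_boole]
    simp

end PairUniform

end PairUniform

/-! ### The uniform choice of a set of given size -/

section BitChoice

variable {F m : ℕ}

instance BitChoice.nonempty_of_fact [hm : Fact (m ≤ F)] : Nonempty (BitChoice F m) := by
  obtain ⟨A, -, hA⟩ := Finset.exists_subset_card_eq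
    (s := (Finset.univ : Finset (Fin F))) (n := m) (by simpa using hm.out)
  exact ⟨⟨A, hA⟩⟩

/-- The law of a uniform choice of `m` bits is invariant under permutations of the bits. -/
lemma expect_bitChoice_perm (σ : Equiv.Perm (Fin F)) (g : Finset (Fin F) → ℝ) :
    𝔼 A : BitChoice F m, g (A.1.map σ.toEmbedding) = 𝔼 A : BitChoice F m, g A.1 :=
  Fintype.expect_equiv (σ.finsetCongr.subtypeEquiv fun A => by simp) _ _ fun A => by simp

lemma exists_perm_pair {b b' c c' : Fin F} (hb : b ≠ b') (hc : c ≠ c') :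
    ∃ σ : Equiv.Perm (Fin F), σ b = c ∧ σ b' = c' := by
  refine ⟨(Equiv.swap b c).trans (Equiv.swap (Equiv.swap b c b') c'), ?_, by simp⟩
  have h : c ≠ Equiv.swap b c b' := fun h => hb <| by
    simpa using congrArg (Equiv.swap b c) h
  simp [Equiv.swap_apply_of_ne_of_ne h hc]

/-- By symmetry all points are equally likely, and so are all pairs of distinct points; the two
common values are read off from the first two moments of the constant cardinality `m`. -/
lemma pairUniform_bitChoice (hm : m ≤ F) :
    PairUniform (fun A : BitChoice F m => A.1) (m / F) (m / F * ((m - 1) / (F - 1))) := by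
  have : Fact (m ≤ F) := ⟨hm⟩
  have hmem (σ : Equiv.Perm (Fin F)) (b : Fin F) (A : Finset (Fin F)) :
      σ b ∈ A.map σ.toEmbedding ↔ b ∈ A := by simp
  have hpoint (b : Fin F) :
      (𝔼 A : BitChoice F m, if b ∈ A.1 then (1 : ℝ) else 0) = m / F := by
    have hF : (F : ℝ) ≠ 0 := Nat.cast_ne_zero.2 b.pos.ne'
    have hsymm (c : Fin F) : (𝔼 A : BitChoice F m, if c ∈ A.1 then (1 : ℝ) else 0) =
        𝔼 A : BitChoice F m, if b ∈ A.1 then (1 : ℝ) else 0 := by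
      rw [← expect_bitChoice_perm (Equiv.swap b c) fun A => if c ∈ A then (1 : ℝ) else 0]
      refine Finset.expect_congr rfl fun A _ => ?_
      have := hmem (Equiv.swap b c) b A.1
      rw [Equiv.swap_apply_left] at this
      simp only [this]
    have hcard : (𝔼 A : BitChoice F m, (A.1.card : ℝ)) = m := by
      simp only [fun A : BitChoice F m => A.2, Fintype.expect_const]
    simp only [cast_card_eq_sum] at hcard
    rw [Finset.expect_sum_comm, Finset.sum_congr rfl fun c _ => hsymm c] at hcard
    rw [eq_div_iff hF, ← hcard]
    simp [mul_comm]
  refine ⟨hpoint, fun b b' hb => ?_⟩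
  have hU : PairUniform (fun A : BitChoice F m => A.1) (m / F)
      (𝔼 A : BitChoice F m, (if b ∈ A.1 then (1 : ℝ) else 0) * if b' ∈ A.1 then 1 else 0) := by
    refine ⟨hpoint, fun c c' hc => ?_⟩
    obtain ⟨σ, rfl, rfl⟩ := exists_perm_pair hb hc
    rw [← expect_bitChoice_perm σ fun A =>
      (if σ b ∈ A then (1 : ℝ) else 0) * if σ b' ∈ A then 1 else 0]
    simp only [hmem]
  have hsq := hU.expect_card_sq
  simp only [fun A : BitChoice F m => A.2, Fintype.expect_const] at hsq
  have hF : (1 : ℝ) < F := by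
    have : 1 < F := by
      have := b.2; have := b'.2; have := Fin.val_ne_of_ne hb; omega
    exact_mod_cast this
  have h0 : (F : ℝ) ≠ 0 := by positivity
  have h1 : (F : ℝ) - 1 ≠ 0 := by linarith
  rw [div_mul_div_comm, eq_div_iff (mul_ne_zero h0 h1)]
  have hcancel : (F : ℝ) * (m / F) = m := mul_div_cancel₀ _ h0
  linear_combination -hcancel - hsq

end BitChoice

/-! ### Convergence in mean -/

section Mean

variable {Ω : ℕ → Type} [∀ F, Fintype (Ω F)]

/-- `X F → c` in `L¹` as `F → ∞`, with `X F` defined on `Ω F` under its uniform law. -/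
def ConvergesInMean (X : ∀ F, Ω F → ℝ) (c : ℝ) : Prop :=
  Tendsto (fun F => 𝔼 ω, |X F ω - c|) atTop (𝓝 0)

lemma unifProb_eq {Ω : Type} [Fintype Ω] (p : Ω → Prop) [DecidablePred p] :
    unifProb {ω | p ω} = ENNReal.ofReal (𝔼 ω, if p ω then (1 : ℝ) else 0) := by
  let _ : MeasurableSpace Ω := ⊤
  have : MeasurableSingletonClass Ω := ⟨fun _ => trivial⟩
  unfold unifProb
  rw [ProbabilityTheory.uniformOn_univ, Fintype.expect_eq_sum_div_card, Finset.sum_boole]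
  have hset : {ω | p ω} = ((Finset.univ.filter p : Finset Ω) : Set Ω) := by simp
  rw [hset, MeasureTheory.Measure.count_apply_finset]
  rcases isEmpty_or_nonempty Ω with h | h
  · simp [Finset.univ_eq_empty]
  · rw [ENNReal.ofReal_div_of_pos (by exact_mod_cast Fintype.card_pos)]
    simp

/-- Markov's inequality. -/
lemma ConvergesInMean.convergesInProbability [∀ F, Nonempty (Ω F)] {X : ∀ F, Ω F → ℝ} {c : ℝ}
    (h : ConvergesInMean X c) : ConvergesInProbability X c := by
  classical
  intro ε hε
  simp only [unifProb_eq]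
  rw [← ENNReal.ofReal_one]
  refine ENNReal.tendsto_ofReal ?_
  have hlow : Tendsto (fun F => 1 - (𝔼 ω, |X F ω - c|) / ε) atTop (𝓝 1) := by
    simpa using (h.div_const ε).const_sub 1
  refine tendsto_of_tendsto_of_tendsto_of_le_of_le hlow tendsto_const_nhds (fun F => ?_) fun F => ?_
  · have hexp : 1 - (𝔼 ω, |X F ω - c|) / ε = 𝔼 ω, (1 - |X F ω - c| / ε) := by
      rw [Finset.expect_sub_distrib, Fintype.expect_const, Finset.expect_div]
    simp only [hexp]
    refine Finset.expect_le_expect fun ω _ => ?_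
    split_ifs with hω
    · have : 0 ≤ |X F ω - c| / ε := by positivity
      linarith
    · have : 1 ≤ |X F ω - c| / ε := (one_le_div hε).2 (not_lt.1 hω)
      linarith
  · refine Finset.expect_le Finset.univ_nonempty fun ω _ => ?_
    split_ifs <;> simp

lemma ConvergesInMean.of_abs_sub_le {ι : Type*} (s : Finset ι) {X : ∀ F, Ω F → ℝ} {c : ℝ}
    {Y : ι → ∀ F, Ω F → ℝ} {e : ι → ℝ} (hY : ∀ i ∈ s, ConvergesInMean (Y i) (e i))
    (h : ∀ F ω, |X F ω - c| ≤ ∑ i ∈ s, |Y i F ω - e i|) : ConvergesInMean X c := by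
  have hsum : Tendsto (fun F => ∑ i ∈ s, 𝔼 ω, |Y i F ω - e i|) atTop (𝓝 0) := by
    simpa using tendsto_finsetSum s hY
  refine squeeze_zero (fun F => Finset.expect_nonneg fun ω _ => abs_nonneg _) (fun F => ?_) hsum
  rw [← Finset.expect_sum_comm]
  exact Finset.expect_le_expect fun ω _ => h F ω

lemma ConvergesInMean.sum {ι : Type*} (s : Finset ι) {Y : ι → ∀ F, Ω F → ℝ} {e : ι → ℝ}
    (hY : ∀ i ∈ s, ConvergesInMean (Y i) (e i)) :
    ConvergesInMean (fun F ω => ∑ i ∈ s, Y i F ω) (∑ i ∈ s, e i) :=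
  .of_abs_sub_le s hY fun F ω => by
    rw [← Finset.sum_sub_distrib]
    exact Finset.abs_sum_le_sum_abs _ _

lemma ConvergesInMean.sup {ι : Type*} {s : Finset ι} (hs : s.Nonempty) {x : ι → ∀ F, Ω F → ℕ}
    {c : ℝ} (hx : ∀ i ∈ s, ConvergesInMean (fun F ω => (x i F ω : ℝ) / F) c) :
    ConvergesInMean (fun F ω => ((s.sup fun i => x i F ω : ℕ) : ℝ) / F) c :=
  .of_abs_sub_le s hx fun F ω => by
    obtain ⟨i, hi, hsup⟩ := Finset.exists_mem_eq_sup s hs fun i => x i F ω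
    rw [hsup]
    exact Finset.single_le_sum (f := fun i => |(x i F ω : ℝ) / F - c|)
      (fun _ _ => abs_nonneg _) hi

end Mean

/-! ### Asymptotic densities of random sets -/

section Density

variable {Ω Ω' : ℕ → Type} [∀ F, Fintype (Ω F)] [∀ F, Fintype (Ω' F)]

/-- The random subsets `A F` of `Fin F` contain each point with a common probability tending to
`c` and each pair of distinct points with a common probability tending to `c ^ 2`: membership of
different points is asymptotically uncorrelated. -/
def HasDensity (A : ∀ F, Ω F → Finset (Fin F)) (c : ℝ) : Prop :=
  ∃ α β : ℕ → ℝ, (∀ F, PairUniform (A F) (α F) (β F)) ∧ Tendsto α atTop (𝓝 c) ∧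
    Tendsto β atTop (𝓝 (c ^ 2))

namespace HasDensity

/-- The second-moment method: the variance of the relative size tends to zero. -/
lemma convergesInMean [∀ F, Nonempty (Ω F)] {A : ∀ F, Ω F → Finset (Fin F)} {c : ℝ}
    (h : HasDensity A c) : ConvergesInMean (fun F ω => ((A F ω).card : ℝ) / F) c := by
  obtain ⟨α, β, hU, hα, hβ⟩ := h
  have hsq : Tendsto (fun F => 𝔼 ω, (((A F ω).card : ℝ) / F - c) ^ 2) atTop (𝓝 0) := by
    have h1 : Tendsto (fun F : ℕ => 1 / (F : ℝ)) atTop (𝓝 0) :=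
      tendsto_one_div_atTop_nhds_zero_nat
    have hlim := ((((hα.mul h1).add ((h1.const_sub 1).mul hβ)).sub (hα.const_mul (2 * c))).add_const
      (c ^ 2))
    have hc : c * 0 + (1 - 0) * c ^ 2 - 2 * c * c + c ^ 2 = 0 := by ring
    rw [hc] at hlim
    refine hlim.congr' ?_
    filter_upwards [eventually_ne_atTop 0] with F hF using ((hU F).expect_sq_sub hF c).symm
  have hsqrt := hsq.sqrt
  rw [Real.sqrt_zero] at hsqrt
  -- Cauchy-Schwarz: the `L¹` norm is at most the `L²` norm.
  refine squeeze_zero (fun F => Finset.expect_nonneg fun ω _ => abs_nonneg _) (fun F => ?_) hsqrt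
  refine Real.le_sqrt_of_sq_le ?_
  simpa using Finset.expect_mul_sq_le_sq_mul_sq Finset.univ
    (fun ω => |((A F ω).card : ℝ) / F - c|) 1

lemma comp {A : ∀ F, Ω F → Finset (Fin F)} {c : ℝ} (h : HasDensity A c) {π : ∀ F, Ω' F → Ω F}
    (hπ : ∀ F, UniformPreserving (π F)) : HasDensity (fun F ω => A F (π F ω)) c := by
  obtain ⟨α, β, hU, hα, hβ⟩ := h
  exact ⟨α, β, fun F => (hU F).comp (hπ F), hα, hβ⟩

lemma compl [∀ F, Nonempty (Ω F)] {A : ∀ F, Ω F → Finset (Fin F)} {c : ℝ} (h : HasDensity A c) :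
    HasDensity (fun F ω => (A F ω)ᶜ) (1 - c) := by
  obtain ⟨α, β, hU, hα, hβ⟩ := h
  refine ⟨_, _, fun F => (hU F).compl, hα.const_sub 1, ?_⟩
  have hc : (1 - c) ^ 2 = 1 - 2 * c + c ^ 2 := by ring
  rw [hc]
  exact ((hα.const_mul 2).const_sub 1).add hβ

lemma inter {A : ∀ F, Ω F → Finset (Fin F)} {B : ∀ F, Ω' F → Finset (Fin F)} {c e : ℝ}
    (hA : HasDensity A c) (hB : HasDensity B e) :
    HasDensity (fun F (ω : Ω F × Ω' F) => A F ω.1 ∩ B F ω.2) (c * e) := by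
  obtain ⟨α, β, hU, hα, hβ⟩ := hA
  obtain ⟨α', β', hU', hα', hβ'⟩ := hB
  exact ⟨_, _, fun F => (hU F).inter (hU' F), hα.mul hα', mul_pow c e 2 ▸ hβ.mul hβ'⟩

lemma iInter {ι : Type} [Fintype ι] [DecidableEq ι] {A : ι → ∀ F, Ω F → Finset (Fin F)}
    {c : ι → ℝ} (h : ∀ k, HasDensity (A k) (c k)) :
    HasDensity (fun F (ω : ι → Ω F) => Finset.univ.filter fun b => ∀ k, b ∈ A k F (ω k))
      (∏ k, c k) := by
  choose α β hU hα hβ using h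
  refine ⟨_, _, fun F => PairUniform.iInter fun k => hU k F, tendsto_finsetProd _ fun k _ => hα k,
    ?_⟩
  rw [← Finset.prod_pow]
  exact tendsto_finsetProd _ fun k _ => hβ k

end HasDensity

variable {m : ℕ → ℕ} {p : ℝ}

lemma hasDensity_bitChoice (hm : ∀ F, m F ≤ F)
    (hp : Tendsto (fun F => (m F : ℝ) / F) atTop (𝓝 p)) :
    HasDensity (fun F (A : BitChoice F (m F)) => A.1) p := by
  refine ⟨_, _, fun F => pairUniform_bitChoice (hm F), hp, ?_⟩
  rw [sq]
  refine hp.mul ?_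
  have h1 : Tendsto (fun F : ℕ => 1 / (F : ℝ)) atTop (𝓝 0) := tendsto_one_div_atTop_nhds_zero_nat
  have hlim := (hp.sub h1).div (h1.const_sub 1) (by norm_num)
  simp only [sub_zero, div_one] at hlim
  refine hlim.congr' ?_
  filter_upwards [eventually_ne_atTop 0] with F hF
  have hF' : (F : ℝ) ≠ 0 := Nat.cast_ne_zero.2 hF
  simp only [Pi.div_apply]
  rw [← sub_div, one_sub_div hF', div_div_div_cancel_right₀ hF']

variable {K N : ℕ}

/-- In a layer whose nodes cache a fraction `p` of each file, a fraction
`p ^ |T| * (1 - p) ^ (K - |T|)` of each file is cached exactly at `T`. -/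
lemma hasDensity_subfile [hm : ∀ F, Fact (m F ≤ F)]
    (hp : Tendsto (fun F => (m F : ℝ) / F) atTop (𝓝 p)) (n : Fin N) (T : Finset (Fin K)) :
    HasDensity (fun F (ω : Fin K → Fin N → BitChoice F (m F)) =>
      subfile (fun k n => (ω k n).1) n T) (p ^ T.card * (1 - p) ^ (K - T.card)) := by
  have hbit := hasDensity_bitChoice (fun F => (hm F).out) hp
  have hn : HasDensity (fun F (y : Fin N → BitChoice F (m F)) => (y n).1) p :=
    hbit.comp fun F => UniformPreserving.eval n
  have hk (k : Fin K) : HasDensity (fun F (y : Fin N → BitChoice F (m F)) =>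
      if k ∈ T then (y n).1 else (y n).1ᶜ) (if k ∈ T then p else 1 - p) := by
    split_ifs
    exacts [hn, hn.compl]
  have hprod : ∏ k : Fin K, (if k ∈ T then p else 1 - p) = p ^ T.card * (1 - p) ^ (K - T.card) := by
    rw [Finset.prod_ite, Finset.prod_const, Finset.prod_const, Finset.filter_mem_eq_inter,
      Finset.univ_inter, Finset.filter_not, Finset.filter_mem_eq_inter, Finset.univ_inter,
      Finset.card_sdiff_of_subset (Finset.subset_univ T), Finset.card_univ, Fintype.card_fin]
  rw [← hprod]
  convert HasDensity.iInter hk using 4 with F ω b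
  unfold subfile
  congr 1
  ext b
  refine forall_congr' fun k => ?_
  by_cases h : k ∈ T <;> simp [h]

end Density

/-! ### The rate of a coded layer -/

section Rate

variable {K N : ℕ}

/-- The limits of the block lengths add up to the closed form of the rate, by the binomial
theorem. -/
lemma sum_nonempty_block_limits (K : ℕ) (p q : ℝ) :
    ∑ S : {S : Finset (Fin K) // S.Nonempty},
        q * (1 - p) / p * (p ^ S.1.card * (1 - p) ^ (K - S.1.card))
      = q * (1 - p) / p * (1 - (1 - p) ^ K) := by
  rw [← Finset.mul_sum]
  congr 1
  have hall : ∑ S : Finset (Fin K), p ^ S.card * (1 - p) ^ (K - S.card) = 1 := by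
    have := Fintype.sum_pow_mul_eq_add_pow (Fin K) p (1 - p)
    simpa using this
  -- The binomial sum runs over all `S`; the empty set, which has no block, is split off.
  rw [← Finset.add_sum_erase _ _ (Finset.mem_univ ∅)] at hall
  rw [← Finset.sum_subtype (Finset.univ.erase ∅)
    (fun S => by simp [Finset.nonempty_iff_ne_empty]) fun S : Finset (Fin K) =>
      p ^ S.card * (1 - p) ^ (K - S.card)]
  simp only [Finset.card_empty, pow_zero, one_mul, Nat.sub_zero] at hall
  linarith

/-- If the wanted part of every subfile has density `q` times that of the subfile, then the
normalized length of the coded message converges to `q * (1 - p) / p * (1 - (1 - p) ^ K)`. -/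
lemma convergesInMean_card_codeIndex {Ω : ℕ → Type} [∀ F, Fintype (Ω F)] [∀ F, Nonempty (Ω F)]
    {C : ∀ F, Ω F → Fin K → Fin N → Finset (Fin F)} {dem : Fin K → Fin N}
    {wanted : ∀ F, Ω F → Fin K → Finset (Fin F)} {p q : ℝ} (hp : p ≠ 0)
    (h : ∀ k T, HasDensity (fun F ω => subfile (C F ω) (dem k) T ∩ wanted F ω k)
      (p ^ T.card * (1 - p) ^ (K - T.card) * q)) :
    ConvergesInMean (fun F ω => (Fintype.card (CodeIndex (C F ω) dem (wanted F ω)) : ℝ) / F)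
      (q * (1 - p) / p * (1 - (1 - p) ^ K)) := by
  simp only [Fintype.card_sigma, Fintype.card_fin, Nat.cast_sum, Finset.sum_div]
  rw [← sum_nonempty_block_limits]
  refine ConvergesInMean.sum _ fun S _ => ConvergesInMean.sup S.2 fun k hk => ?_
  have hcard : (S.1.erase k).card + 1 = S.1.card := Finset.card_erase_add_one hk
  have hle : S.1.card ≤ K := by simpa using Finset.card_le_univ S.1
  have hlim : q * (1 - p) / p * (p ^ S.1.card * (1 - p) ^ (K - S.1.card)) =
      p ^ (S.1.erase k).card * (1 - p) ^ (K - (S.1.erase k).card) * q := by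
    have hK : K - (S.1.erase k).card = K - S.1.card + 1 := by omega
    rw [hK, ← hcard]
    field_simp
    ring
  rw [hlim]
  exact (h k (S.1.erase k)).convergesInMean

end Rate

/-! ### The two-layer network -/

section Network

lemma bitsPerFile_le {M : ℝ} {N : ℕ} (hMN : M ≤ N) (F : ℕ) : bitsPerFile M N F ≤ F := by
  refine Nat.floor_le_of_le ?_
  rcases N.eq_zero_or_pos with rfl | hN
  · simp
  · rw [div_le_iff₀ (by exact_mod_cast hN), mul_comm]
    gcongr

lemma mul_bitsPerFile_le {M : ℝ} (hM : 0 ≤ M) (N F : ℕ) : (N * bitsPerFile M N F : ℝ) ≤ M * F := by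
  rcases N.eq_zero_or_pos with rfl | hN
  · simp; positivity
  · have hN' : (0 : ℝ) < N := by exact_mod_cast hN
    rw [mul_comm, ← le_div_iff₀ hN']
    exact Nat.floor_le (by positivity)

lemma tendsto_bitsPerFile_div {M : ℝ} (hM : 0 ≤ M) (N : ℕ) :
    Tendsto (fun F : ℕ => (bitsPerFile M N F : ℝ) / F) atTop (𝓝 (M / N)) := by
  have h := (tendsto_nat_floor_mul_div_atTop (R := ℝ) (a := M / N) (by positivity)).comp
    tendsto_natCast_atTop_atTop
  refine h.congr fun F => ?_
  simp [bitsPerFile, div_mul_eq_mul_div]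

variable {K1 K2 N : ℕ} {m1 m2 : ℕ → ℕ} [hm1 : ∀ F, Fact (m1 F ≤ F)] [hm2 : ∀ F, Fact (m2 F ≤ F)]
  {p q : ℝ}

lemma serverRate_eq_sum {F m1 m2 : ℕ} (ω : Placement K1 K2 N F m1 m2) (d : Fin K1 → Fin K2 → Fin N)
    (wanted : Fin K1 → Fin K2 → Finset (Fin F)) :
    serverRate ω d wanted = ∑ j, (Fintype.card
      (CodeIndex (helperSets ω) (fun i => d i j) (fun i => wanted i j)) : ℝ) / F := by
  rw [serverRate, Fintype.card_sigma, Nat.cast_sum, Finset.sum_div]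

lemma convergesInMean_serverRate_wantedSC (hp0 : p ≠ 0)
    (hp : Tendsto (fun F => (m1 F : ℝ) / F) atTop (𝓝 p))
    (hq : Tendsto (fun F => (m2 F : ℝ) / F) atTop (𝓝 q)) (d : Fin K1 → Fin K2 → Fin N) :
    ConvergesInMean (fun F (ω : Placement K1 K2 N F (m1 F) (m2 F)) =>
      serverRate ω d (wantedSC ω d)) (K2 * ((1 - q) * (1 - p) / p * (1 - (1 - p) ^ K1))) := by
  have hconst : (K2 * ((1 - q) * (1 - p) / p * (1 - (1 - p) ^ K1)) : ℝ) =
      ∑ _j : Fin K2, (1 - q) * (1 - p) / p * (1 - (1 - p) ^ K1) := by simp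
  simp only [serverRate_eq_sum]
  rw [hconst]
  refine ConvergesInMean.sum _ fun j _ => convergesInMean_card_codeIndex hp0 fun i T => ?_
  have huser : HasDensity (fun F (y : Fin K1 → Fin K2 → Fin N → BitChoice F (m2 F)) =>
      (y i j (d i j)).1) q :=
    (hasDensity_bitChoice (fun F => (hm2 F).out) hq).comp
      (π := fun F (y : Fin K1 → Fin K2 → Fin N → BitChoice F (m2 F)) => y i j (d i j)) fun F =>
        (UniformPreserving.eval (d i j)).comp
          ((UniformPreserving.eval j).comp (UniformPreserving.eval i))
  exact (hasDensity_subfile hp (d i j) T).inter huser.compl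

lemma convergesInMean_serverRate_wantedA (hp0 : p ≠ 0)
    (hp : Tendsto (fun F => (m1 F : ℝ) / F) atTop (𝓝 p)) (d : Fin K1 → Fin K2 → Fin N) :
    ConvergesInMean (fun F (ω : Placement K1 K2 N F (m1 F) (m2 F)) =>
      serverRate ω d (wantedA K1 K2 F)) (K2 * ((1 - p) / p * (1 - (1 - p) ^ K1))) := by
  have hconst : (K2 * ((1 - p) / p * (1 - (1 - p) ^ K1)) : ℝ) =
      ∑ _j : Fin K2, 1 * (1 - p) / p * (1 - (1 - p) ^ K1) := by simp
  simp only [serverRate_eq_sum]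
  rw [hconst]
  refine ConvergesInMean.sum _ fun j _ => convergesInMean_card_codeIndex hp0 fun i T => ?_
  simp only [wantedA, Finset.inter_univ, mul_one]
  exact (hasDensity_subfile hp (d i j) T).comp
    (π := fun F (ω : Placement K1 K2 N F (m1 F) (m2 F)) => ω.1) fun F => UniformPreserving.fst

lemma convergesInMean_helperRate (hq0 : q ≠ 0)
    (hq : Tendsto (fun F => (m2 F : ℝ) / F) atTop (𝓝 q)) (d : Fin K1 → Fin K2 → Fin N)
    (i : Fin K1) :
    ConvergesInMean (fun F (ω : Placement K1 K2 N F (m1 F) (m2 F)) => helperRate ω d i)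
      ((1 - q) / q * (1 - (1 - q) ^ K2)) := by
  have hconst : (1 - q) / q * (1 - (1 - q) ^ K2) = 1 * (1 - q) / q * (1 - (1 - q) ^ K2) := by simp
  rw [hconst]
  refine convergesInMean_card_codeIndex (C := fun F (ω : Placement K1 K2 N F (m1 F) (m2 F)) =>
    userSets ω i) (wanted := fun _ _ _ => Finset.univ) hq0 fun j T => ?_
  simp only [Finset.inter_univ, mul_one]
  exact (hasDensity_subfile hq (d i j) T).comp
    (π := fun F (ω : Placement K1 K2 N F (m1 F) (m2 F)) => ω.2 i) fun F =>
      (UniformPreserving.eval i).comp UniformPreserving.snd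

lemma convergesInMean_maxHelperRate (hK1 : 0 < K1) (hq0 : q ≠ 0)
    (hq : Tendsto (fun F => (m2 F : ℝ) / F) atTop (𝓝 q)) (d : Fin K1 → Fin K2 → Fin N) :
    ConvergesInMean (fun F (ω : Placement K1 K2 N F (m1 F) (m2 F)) => maxHelperRate ω d)
      ((1 - q) / q * (1 - (1 - q) ^ K2)) :=
  have : Nonempty (Fin K1) := ⟨⟨0, hK1⟩⟩
  ConvergesInMean.sup Finset.univ_nonempty fun i _ => convergesInMean_helperRate hq0 hq d i

end Network

/-! ### The closed forms -/

lemma R1SC_eq (K1 K2 N : ℕ) (M1 M2 : ℝ) :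
    R1SC K1 K2 N M1 M2 = (1 - M2 / N) * R1A K1 K2 N M1 := by
  unfold R1SC R1A
  ring

lemma R1A_pos {K1 K2 N : ℕ} {M1 : ℝ} (hK1 : K1 ≠ 0) (hK2 : K2 ≠ 0) (hM1 : 0 < M1) (hM1N : M1 < N) :
    0 < R1A K1 K2 N M1 := by
  have hN : (0 : ℝ) < N := hM1.trans hM1N
  have h1 : M1 / N < 1 := (div_lt_one hN).2 hM1N
  have h0 : 0 < M1 / N := by positivity
  have hpow : (1 - M1 / N) ^ K1 < 1 := pow_lt_one₀ (by linarith) (by linarith) hK1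
  have hK2' : (0 : ℝ) < K2 := by positivity
  unfold R1A
  exact mul_pos (mul_pos (mul_pos hK2' (by linarith)) (by positivity)) (by linarith)

end TwoLayerCaching

theorem lemma1 (K1 K2 N : ℕ) (hK1 : 2 ≤ K1) (hK2 : 2 ≤ K2) (M1 M2 : ℝ)
    (hM1 : 0 ≤ M1) (hM1N : M1 ≤ N) (hM2 : 0 ≤ M2) (hM2N : M2 ≤ N)
    (d : Fin K1 → Fin K2 → Fin N) :
    -- the caches respect the memory sizes; delivery in both schemes never fails
    (∀ (F : ℕ) (ω : Placement K1 K2 N F (bitsPerFile M1 N F) (bitsPerFile M2 N F)),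
      (∀ i, ((∑ n, (helperSets ω i n).card : ℕ) : ℝ) ≤ M1 * F) ∧
      (∀ i j, ((∑ n, (userSets ω i j n).card : ℕ) : ℝ) ≤ M2 * F) ∧
      HelpersCanSend ω d (wantedSC ω d) ∧
      HelpersResolve ω d (wantedA K1 K2 F) ∧
      HelpersCanSend ω d (wantedA K1 K2 F) ∧
      UsersRecover ω d) ∧
    -- server rates of schemes S&C and A
    (0 < M1 →
      ConvergesInProbability
        (fun F (ω : Placement K1 K2 N F (bitsPerFile M1 N F) (bitsPerFile M2 N F)) =>
          serverRate ω d (wantedSC ω d)) (R1SC K1 K2 N M1 M2) ∧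
      ConvergesInProbability
        (fun F (ω : Placement K1 K2 N F (bitsPerFile M1 N F) (bitsPerFile M2 N F)) =>
          serverRate ω d (wantedA K1 K2 F)) (R1A K1 K2 N M1)) ∧
    -- helper rates of schemes S&C and A (whose helper messages are the same)
    (0 < M2 →
      ConvergesInProbability
        (fun F (ω : Placement K1 K2 N F (bitsPerFile M1 N F) (bitsPerFile M2 N F)) =>
          maxHelperRate ω d) (R2SC K2 N M2) ∧
      (∀ i, ConvergesInProbability
        (fun F (ω : Placement K1 K2 N F (bitsPerFile M1 N F) (bitsPerFile M2 N F)) =>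
          helperRate ω d i) (R2SC K2 N M2)) ∧
      R2SC K2 N M2 = R2A K2 N M2) ∧
    -- comparison of the server rates
    R1SC K1 K2 N M1 M2 = (1 - M2 / N) * R1A K1 K2 N M1 ∧
    (0 < M1 → M1 < N → 0 < M2 → R1SC K1 K2 N M1 M2 < R1A K1 K2 N M1) := by
  have hm1 (F : ℕ) : Fact (bitsPerFile M1 N F ≤ F) := ⟨bitsPerFile_le hM1N F⟩
  have hm2 (F : ℕ) : Fact (bitsPerFile M2 N F ≤ F) := ⟨bitsPerFile_le hM2N F⟩
  have hN : (0 : ℝ) < N := by exact_mod_cast (d ⟨0, by omega⟩ ⟨0, by omega⟩).pos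
  have hp := tendsto_bitsPerFile_div hM1 N
  have hq := tendsto_bitsPerFile_div hM2 N
  refine ⟨fun F ω => ⟨fun i => ?_, fun i j => ?_, ?_, helpersResolve_wantedA ω d, ?_,
    usersRecover ω d⟩, fun hM1pos => ?_, fun hM2pos => ?_, R1SC_eq K1 K2 N M1 M2,
    fun hM1pos hM1lt hM2pos => ?_⟩
  · simpa [helperSets, fun n => (ω.1 i n).2] using mul_bitsPerFile_le hM1 N F
  · simpa [userSets, fun n => (ω.2 i j n).2] using mul_bitsPerFile_le hM2 N F
  · exact helpersCanSend_of_compl_subset ω d fun i j => subset_rfl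
  · exact helpersCanSend_of_compl_subset ω d fun i j => Finset.subset_univ _
  · have hp0 : M1 / N ≠ 0 := by positivity
    have hSC : R1SC K1 K2 N M1 M2 =
        K2 * ((1 - M2 / N) * (1 - M1 / N) / (M1 / N) * (1 - (1 - M1 / N) ^ K1)) := by
      rw [R1SC, ← inv_div M1 (N : ℝ)]
      ring
    have hA : R1A K1 K2 N M1 = K2 * ((1 - M1 / N) / (M1 / N) * (1 - (1 - M1 / N) ^ K1)) := by
      rw [R1A, ← inv_div M1 (N : ℝ)]
      ring
    rw [hSC, hA]
    exact ⟨(convergesInMean_serverRate_wantedSC hp0 hp hq d).convergesInProbability,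
      (convergesInMean_serverRate_wantedA hp0 hp d).convergesInProbability⟩
  · have hq0 : M2 / N ≠ 0 := by positivity
    have hR : R2SC K2 N M2 = (1 - M2 / N) / (M2 / N) * (1 - (1 - M2 / N) ^ K2) := by
      rw [R2SC, ← inv_div M2 (N : ℝ), div_eq_mul_inv (1 - M2 / (N : ℝ))]
    refine ⟨?_, fun i => ?_, rfl⟩ <;> rw [hR]
    · exact (convergesInMean_maxHelperRate (by omega) hq0 hq d).convergesInProbability
    · exact (convergesInMean_helperRate hq0 hq d i).convergesInProbability
  · have hpos : 0 < R1A K1 K2 N M1 := R1A_pos (by omega) (by omega) hM1pos hM1lt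
    have hlt : 1 - M2 / N < 1 := sub_lt_self _ (by positivity)
    rw [R1SC_eq]
    exact mul_lt_of_lt_one_left hpos hlt
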